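/- All graphs are finite and simple. Let $G$ be a graph with an edge colouring (not necessarily proper) $\lambda:E(G)\to[n]$. Its colour classes are the sets $\lambda^{-1}(i)$, $i\in[n]$; a cycle of $G$ is rainbow if no two of its edges have the same colour; and the rainbow girth is the minimum length of a rainbow cycle ($\infty$ if there is none). A set of edges is a star if all its edges share a common vertex. (a) There exists $L_0>0$ such that for all real $0\le c\le \frac12$ and $L\ge L_0$ the following holds. Let $n\ge 1$ and let $G$ be an $n$-vertex graph with an edge colouring with $n$ colours such that each colour class has size at least two. If at least $L\,n^{1-c}$ of the colour classes contain a matching of size two or a triangle, then the rainbow girth of $G$ is at most $$\frac{2\log_2 K}{K}\,n,\qquad\text{where } K=\frac{L}{100}\,n^{1-2c}.$$ (b) In particular, among $n$ colour classes of size at least two, $\omega(\sqrt n)$ non-star classes force rainbow girth $o(n)$: for every function $g:\mathbb N\to\mathbb R$ with $g(n)/\sqrt n\to\infty$ and every $\varepsilon>0$ there is $N$ such that for all $n\ge N$, every $n$-vertex graph with an edge colouring with $n$ colours, in which each colour class has size at least two and at least $g(n)$ of the colour classes are not stars, has rainbow girth at most $\varepsilon n$. -/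

import Mathlib

namespace RainbowGirth

/-- An edge set contains a matching of size two: two of its edges share no vertex. -/
def ContainsTwoMatching {V : Type*} (F : Set (Sym2 V)) : Prop :=
  ∃ e ∈ F, ∃ f ∈ F, ∀ v : V, v ∈ e → v ∉ f

/-- An edge set contains the three edges of a triangle. -/
def ContainsTriangle {V : Type*} (F : Set (Sym2 V)) : Prop :=
  ∃ a b c : V, a ≠ b ∧ b ≠ c ∧ a ≠ c ∧ s(a, b) ∈ F ∧ s(b, c) ∈ F ∧ s(a, c) ∈ F

/-- An edge set is a star: all of its edges share a common vertex. -/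
def IsStar {V : Type*} (F : Set (Sym2 V)) : Prop :=
  ∃ v : V, ∀ e ∈ F, v ∈ e

/-- The colour class of the colour `i`: the set of all edges of `G` that receive the colour `i`. -/
def colorClass {V K : Type*} {G : SimpleGraph V} (C : G.EdgeLabeling K) (i : K) :
    Set (Sym2 V) :=
  {e | ∃ h : e ∈ G.edgeSet, C ⟨e, h⟩ = i}

/-- A subgraph of `G` is rainbow if no two of its edges belong to the same colour class. -/
def IsRainbow {V K : Type*} {G : SimpleGraph V} (C : G.EdgeLabeling K) (H : G.Subgraph) : Prop :=
  ∀ i : K, (H.edgeSet ∩ colorClass C i).Subsingleton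

/-- The rainbow girth: the minimum length of a rainbow cycle, and `⊤` if there is none. -/
noncomputable def rainbowGirth {V K : Type*} {G : SimpleGraph V} (C : G.EdgeLabeling K) : ℕ∞ :=
  ⨅ (a : V) (w : G.Walk a a) (_ : w.IsCycle) (_ : IsRainbow C w.toSubgraph), (w.length : ℕ∞)

/-- The rainbow girth as an extended real number, for comparison with real bounds. -/
noncomputable def rainbowGirthEReal {V K : Type*} {G : SimpleGraph V}
    (C : G.EdgeLabeling K) : EReal :=
  ((ENat.toENNReal (rainbowGirth C) : ENNReal) : EReal)

end RainbowGirth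

namespace RainbowGirth

open Finset

/-! Keep each vertex independently with probability `1 - p`. A class of two or more edges retains an
edge inside the kept set `S` with probability at least `1 - p - p ^ 2`, nearly matching the
proportion of vertices kept; with a two-matching or a triangle this improves to `1 - 4 * p ^ 2`. If
`m` classes are of the better kind, a suitable `p` of order `m / n` gives an `S` meeting at least
`#S + m ^ 2 / (16 n)` colours (`exists_many_survivors`). One edge per colour then forms a rainbow
graph with excess `k` inside `S`, and `exists_short_cycle` applies: a vertex set `U` maximising
edges minus `(1 + k / n) #U` is expanding, so without short cycles its breadth-first balls would
outgrow the graph. Both claims follow from the resulting `rainbowGirthEReal_le_of_lt` by choosing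
`k`. -/

/-! ### Short cycles in graphs with more edges than vertices -/

lemma exists_isCycle_of_notMem_edges {V : Type*} {H : SimpleGraph V} {x y : V} (h : H.Adj x y)
    (w : H.Walk x y) (hw : s(x, y) ∉ w.edges) :
    ∃ (u : V) (c : H.Walk u u), c.IsCycle ∧ c.length ≤ w.length + 1 := by
  classical
  refine ⟨y, .cons h.symm w.bypass, ?_, ?_⟩
  · rw [SimpleGraph.Walk.cons_isCycle_iff]
    refine ⟨w.bypass_isPath, fun hmem => hw ?_⟩
    rw [Sym2.eq_swap]
    exact w.edges_bypass_subset_edges hmem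
  · simpa using w.length_bypass_le_length

open Classical in
/-- The edges of `H` with both ends in `W`. -/
noncomputable def edgesIn {V : Type*} [Fintype V] (H : SimpleGraph V) (W : Finset V) :
    Finset (Sym2 V) :=
  H.edgeFinset.filter fun e => ∀ v ∈ e, v ∈ W

lemma mem_edgesIn {V : Type*} [Fintype V] {H : SimpleGraph V} {W : Finset V} {e : Sym2 V} :
    e ∈ edgesIn H W ↔ e ∈ H.edgeSet ∧ ∀ v ∈ e, v ∈ W := by
  classical
  simp [edgesIn]

lemma edgesIn_empty {V : Type*} [Fintype V] (H : SimpleGraph V) : edgesIn H ∅ = ∅ := by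
  ext e
  induction e with
  | _ x y => simpa [mem_edgesIn] using fun _ => ⟨x, fun h => absurd rfl h⟩

/-- One step of breadth-first search in a graph without short cycles: if `T` is the edge set of a
tree on `B` of radius at most `r` around `v`, then all edges of `U` touching `B` belong to the edge
set of a tree of radius at most `r + 1`. -/
lemma exists_bfs_step {V : Type*} [Fintype V] (H : SimpleGraph V) (r : ℕ)
    (hH : ∀ (u : V) (c : H.Walk u u), c.IsCycle → 2 * r + 2 < c.length)
    (U B : Finset V) (T : Finset (Sym2 V)) (v : V) (hBU : B ⊆ U) (hv : v ∈ B)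
    (hT : #T + 1 ≤ #B)
    (hwalk : ∀ w ∈ B, ∃ p : H.Walk v w, p.length ≤ r ∧ ∀ e ∈ p.edges, e ∈ T) :
    ∃ (B' : Finset V) (T' : Finset (Sym2 V)), B' ⊆ U ∧ v ∈ B' ∧ #T' + 1 ≤ #B' ∧
      (∀ w ∈ B', ∃ p : H.Walk v w, p.length ≤ r + 1 ∧ ∀ e ∈ p.edges, e ∈ T') ∧
      ∀ e ∈ edgesIn H U, (∃ x ∈ e, x ∈ B) → e ∈ T' := by
  classical
  set N : Finset V := (U \ B).filter fun y => ∃ x ∈ B, H.Adj x y with hN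
  have hpar : ∀ y : V, ∃ x : V, y ∈ N → x ∈ B ∧ H.Adj x y := by
    intro y
    by_cases hy : y ∈ N
    · obtain ⟨x, hx⟩ := (mem_filter.1 hy).2
      exact ⟨x, fun _ => hx⟩
    · exact ⟨y, fun h => absurd h hy⟩
  choose par hpar using hpar
  -- Each new vertex brings exactly one edge, to a chosen parent, so the tree count is preserved.
  set T' : Finset (Sym2 V) := T ∪ N.image fun y => s(par y, y) with hT'
  have hdisj : Disjoint B N :=
    disjoint_left.2 fun a ha haN => (mem_sdiff.1 (mem_filter.1 haN).1).2 ha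
  have hwalk' : ∀ w ∈ B ∪ N, ∃ p : H.Walk v w, p.length ≤ r + (if w ∈ B then 0 else 1) ∧
      ∀ e ∈ p.edges, e ∈ T' := by
    intro w hw
    by_cases hwB : w ∈ B
    · obtain ⟨p, hp, hpT⟩ := hwalk w hwB
      exact ⟨p, by simpa [hwB] using hp, fun e he => mem_union_left _ (hpT e he)⟩
    · have hwN : w ∈ N := (mem_union.1 hw).resolve_left hwB
      obtain ⟨hx, hadj⟩ := hpar w hwN
      obtain ⟨p, hp, hpT⟩ := hwalk _ hx
      refine ⟨p.concat hadj, by simpa [hwB] using hp, fun e he => ?_⟩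
      rw [SimpleGraph.Walk.edges_concat, List.concat_eq_append, List.mem_append,
        List.mem_singleton] at he
      rcases he with he | rfl
      · exact mem_union_left _ (hpT e he)
      · exact mem_union_right _ (mem_image_of_mem (fun y => s(par y, y)) hwN)
  refine ⟨B ∪ N, T', ?_, mem_union_left _ hv, ?_, ?_, ?_⟩
  · exact union_subset hBU ((filter_subset _ _).trans sdiff_subset)
  · rw [card_union_of_disjoint hdisj]
    have h1 : #T' ≤ _ := card_union_le T (N.image fun y => s(par y, y))
    have h2 := card_image_le (s := N) (f := fun y => s(par y, y))
    omega
  · intro w hw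
    obtain ⟨p, hp, hpT⟩ := hwalk' w hw
    exact ⟨p, hp.trans (by split_ifs <;> omega), hpT⟩
  · rintro e he ⟨x, hxe, hxB⟩
    obtain ⟨y, rfl⟩ := Sym2.mem_iff_exists.1 hxe
    obtain ⟨hadj, hU⟩ := mem_edgesIn.1 he
    rw [SimpleGraph.mem_edgeSet] at hadj
    by_contra hnot
    have hy : y ∈ B ∪ N := by
      by_cases hyB : y ∈ B
      · exact mem_union_left _ hyB
      · exact mem_union_right _
          (mem_filter.2 ⟨mem_sdiff.2 ⟨hU y (by simp), hyB⟩, x, hxB, hadj⟩)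
    -- Tree walks of lengths at most `r` to `x` and `r + 1` to `y`, closed by the non-tree edge
    -- `xy`, yield a cycle of length at most `2 * r + 2`.
    obtain ⟨p, hp, hpT⟩ := hwalk' x (mem_union_left _ hxB)
    obtain ⟨q, hq, hqT⟩ := hwalk' y hy
    obtain ⟨u, c, hc, hlen⟩ := exists_isCycle_of_notMem_edges hadj (p.reverse.append q) (by
      rw [SimpleGraph.Walk.edges_append, List.mem_append, SimpleGraph.Walk.edges_reverse,
        List.mem_reverse]
      rintro (h | h)
      · exact hnot (hpT _ h)
      · exact hnot (hqT _ h))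
    have := hH u c hc
    rw [SimpleGraph.Walk.length_append, SimpleGraph.Walk.length_reverse] at hlen
    rw [if_pos hxB] at hp
    have : (if y ∈ B then 0 else 1) ≤ 1 := by split_ifs <;> omega
    omega

/-- If every nonempty subset of `U` touches at least `(1 + δ)` times as many edges inside `U` as it
has vertices, then balls in a graph without short cycles grow exponentially. -/
lemma exists_ball_growth {V : Type*} [Fintype V] (H : SimpleGraph V) (R : ℕ)
    (hH : ∀ (u : V) (c : H.Walk u u), c.IsCycle → 2 * R < c.length)
    (U : Finset V) (δ : ℝ) (hδ : 0 ≤ δ) (hU : U.Nonempty)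
    (hexp : ∀ W ⊆ U, (1 + δ) * #W ≤ #(edgesIn H U) - #(edgesIn H (by classical exact U \ W))) :
    (1 + δ) ^ (R + 1) ≤ 1 + δ * #U := by
  classical
  obtain ⟨v, hv⟩ := hU
  have key : ∀ r ≤ R, ∃ (B : Finset V) (T : Finset (Sym2 V)), B ⊆ U ∧ v ∈ B ∧ #T + 1 ≤ #B ∧
      (∀ w ∈ B, ∃ p : H.Walk v w, p.length ≤ r ∧ ∀ e ∈ p.edges, e ∈ T) ∧
      (1 + δ) ^ (r + 1) ≤ 1 + δ * #B := by
    intro r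
    induction r with
    | zero =>
      intro _
      refine ⟨{v}, ∅, by simpa using hv, by simp, by simp, ?_, by simp⟩
      intro w hw
      obtain rfl := mem_singleton.1 hw
      exact ⟨.nil, by simp, by simp⟩
    | succ r ih =>
      intro hr
      obtain ⟨B, T, hBU, hvB, hTB, hwalk, hgrow⟩ := ih (by omega)
      obtain ⟨B', T', hBU', hvB', hTB', hwalk', hedge⟩ := exists_bfs_step H r
        (fun u c hc => by have := hH u c hc; omega) U B T v hBU hvB hTB hwalk
      refine ⟨B', T', hBU', hvB', hTB', hwalk', ?_⟩
      have hsub : edgesIn H U ⊆ edgesIn H (U \ B) ∪ T' := by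
        intro e he
        by_cases hx : ∃ x ∈ e, x ∈ B
        · exact mem_union_right _ (hedge e he hx)
        · push Not at hx
          refine mem_union_left _ (mem_edgesIn.2 ⟨(mem_edgesIn.1 he).1, fun x hxe => ?_⟩)
          exact mem_sdiff.2 ⟨(mem_edgesIn.1 he).2 x hxe, hx x hxe⟩
      have hcard : (#(edgesIn H U) : ℝ) ≤ #(edgesIn H (U \ B)) + #T' := by
        exact_mod_cast (card_le_card hsub).trans (card_union_le _ _)
      have hTB'' : (#T' : ℝ) + 1 ≤ #B' := by exact_mod_cast hTB'
      have := hexp B hBU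
      -- All edges of `U` touching `B` are tree edges on `B'`, so expansion bounds `#B'` below. The
      -- invariant `1 + δ * #B` is the quantity this recursion multiplies by `1 + δ`.
      have hB' : 1 + (1 + δ) * #B ≤ (#B' : ℝ) := by linarith
      calc (1 + δ) ^ (r + 1 + 1) = (1 + δ) ^ (r + 1) * (1 + δ) := pow_succ _ _
        _ ≤ (1 + δ * #B) * (1 + δ) := by gcongr
        _ = 1 + δ * (1 + (1 + δ) * #B) := by ring
        _ ≤ 1 + δ * #B' := by gcongr
  obtain ⟨B, T, hBU, -, -, -, h⟩ := key R le_rfl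
  refine h.trans ?_
  have : (#B : ℝ) ≤ #U := by exact_mod_cast card_le_card hBU
  gcongr

/-- A graph with more than `#S + k` edges inside a set `S` of at most `n` vertices has a cycle of
length at most `2 (n / k) log₂ (1 + k)`. -/
theorem exists_short_cycle {V : Type*} [Fintype V] (H : SimpleGraph V) (S : Finset V) (n k : ℝ)
    (hk : 0 < k) (hkn : k ≤ n) (hS : (Fintype.card V : ℝ) ≤ n)
    (hE : (#S : ℝ) + k < #(edgesIn H S)) :
    ∃ (u : V) (c : H.Walk u u), c.IsCycle ∧ (c.length : ℝ) ≤ 2 * (n / k) * Real.logb 2 (1 + k) := by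
  classical
  have hn : 0 < n := hk.trans_le hkn
  set δ : ℝ := k / n with hδ
  have hδ0 : 0 < δ := div_pos hk hn
  have hδ1 : δ ≤ 1 := (div_le_one hn).2 hkn
  have hδn : δ * n = k := div_mul_cancel₀ k hn.ne'
  have hcard : ∀ W : Finset V, (#W : ℝ) ≤ n := fun W =>
    le_trans (by exact_mod_cast card_le_univ W) hS
  -- Comparing `U` with `U \ W` gives the expansion hypothesis; comparing it with `S`, whose value
  -- is positive, shows that `U` is not empty.
  obtain ⟨U, -, hU⟩ := exists_max_image (univ : Finset (Finset V))
    (fun W => (#(edgesIn H W) : ℝ) - (1 + δ) * #W) univ_nonempty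
  have hUne : U.Nonempty := by
    rw [nonempty_iff_ne_empty]
    rintro rfl
    have h := hU S (mem_univ _)
    have : δ * #S ≤ k := hδn ▸ mul_le_mul_of_nonneg_left (hcard S) hδ0.le
    simp only [edgesIn_empty, card_empty, Nat.cast_zero] at h
    linarith
  by_contra! hno
  set X : ℝ := n / k * Real.logb 2 (1 + k) with hX
  have hX0 : 0 ≤ X := mul_nonneg (div_pos hn hk).le (Real.logb_nonneg (by norm_num) (by linarith))
  have hgrow := exists_ball_growth H ⌊X⌋₊ (fun u c hc => by
      have h1 := hno u c hc
      have h2 := Nat.floor_le hX0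
      have : ((2 * ⌊X⌋₊ : ℕ) : ℝ) < c.length := by
        push_cast
        linarith
      exact_mod_cast this) U δ hδ0.le hUne (fun W hW => by
      have h := hU (U \ W) (mem_univ _)
      have h2 : (#(U \ W) : ℝ) = #U - #W := by
        rw [card_sdiff_of_subset hW, Nat.cast_sub (card_le_card hW)]
      simp only [h2] at h
      linarith)
  -- Bernoulli's inequality for exponents in `[0, 1]`; this is where `k ≤ n` matters.
  have h2 : (2 : ℝ) ^ δ ≤ 1 + δ := by
    have := rpow_one_add_le_one_add_mul_self (s := 1) (by norm_num) hδ0.le hδ1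
    norm_num at this
    linarith
  have h3 : (2 : ℝ) ^ (δ * ((⌊X⌋₊ + 1 : ℕ) : ℝ)) ≤ 1 + k := by
    rw [Real.rpow_mul (by norm_num), Real.rpow_natCast]
    refine (pow_le_pow_left₀ (by positivity) h2 _).trans (hgrow.trans ?_)
    have := mul_le_mul_of_nonneg_left (hcard U) hδ0.le
    linarith
  rw [← Real.le_logb_iff_rpow_le (by norm_num) (by linarith)] at h3
  have h4 : X < ((⌊X⌋₊ + 1 : ℕ) : ℝ) := by
    push_cast
    exact Nat.lt_floor_add_one X
  have h5 : δ * X = Real.logb 2 (1 + k) := by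
    rw [hX, hδ]
    field_simp
  have := mul_lt_mul_of_pos_left h4 hδ0
  linarith

/-! ### Multi-affine functions: expectation over a random vertex set -/

/-- A function on `V → ℝ` that is affine in each coordinate separately. -/
def MultiAffine {V : Type*} [DecidableEq V] (F : (V → ℝ) → ℝ) : Prop :=
  ∀ (x : V → ℝ) (v : V) (t : ℝ), F (Function.update x v t) =
    (1 - t) * F (Function.update x v 0) + t * F (Function.update x v 1)

/-- A function affine in each coordinate is at some point of `{0, 1} ^ V` at least as large as at a
given point of the cube. -/
lemma MultiAffine.exists_indicator_ge {V : Type*} [Fintype V] [DecidableEq V]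
    {F : (V → ℝ) → ℝ} (hF : MultiAffine F) (x : V → ℝ) (hx : ∀ v, 0 ≤ x v ∧ x v ≤ 1) :
    ∃ S : Finset V, F x ≤ F fun v => if v ∈ S then 1 else 0 := by
  -- Round the coordinates one at a time: along each, the value is a convex combination of the two
  -- endpoint values, so one endpoint does not decrease it.
  have key : ∀ A : Finset V, ∃ y : V → ℝ, F x ≤ F y ∧ (∀ v ∈ A, y v = 0 ∨ y v = 1) ∧
      ∀ v, 0 ≤ y v ∧ y v ≤ 1 := by
    intro A
    induction A using Finset.induction_on with
    | empty => exact ⟨x, le_rfl, by simp, hx⟩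
    | insert a A _ ih =>
      obtain ⟨y, hy, hyA, hy01⟩ := ih
      have h := hF y a (y a)
      rw [Function.update_eq_self] at h
      have hor : F y ≤ F (Function.update y a 0) ∨ F y ≤ F (Function.update y a 1) := by
        obtain ⟨h0, h1⟩ := hy01 a
        rcases le_total (F (Function.update y a 0)) (F (Function.update y a 1)) with hle | hle
        · right
          nlinarith
        · left
          nlinarith
      have aux : ∀ t : ℝ, t = 0 ∨ t = 1 → F y ≤ F (Function.update y a t) →
          ∃ y : V → ℝ, F x ≤ F y ∧ (∀ v ∈ insert a A, y v = 0 ∨ y v = 1) ∧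
            ∀ v, 0 ≤ y v ∧ y v ≤ 1 := by
        intro t ht hle
        refine ⟨Function.update y a t, hy.trans hle, ?_, ?_⟩
        · intro v hv
          by_cases hva : v = a
          · simpa [hva] using ht
          · simpa [hva] using hyA v ((mem_insert.1 hv).resolve_left hva)
        · intro v
          by_cases hva : v = a
          · rcases ht with rfl | rfl <;> simp [hva]
          · simpa [hva] using hy01 v
      rcases hor with h' | h'
      · exact aux 0 (Or.inl rfl) h'
      · exact aux 1 (Or.inr rfl) h'
  obtain ⟨y, hy, hy01, -⟩ := key univ
  refine ⟨univ.filter fun v => y v = 1, hy.trans_eq (congrArg F ?_)⟩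
  ext v
  rcases hy01 v (mem_univ v) with h | h <;> simp [h]

lemma MultiAffine.sum {V ι : Type*} [DecidableEq V] (s : Finset ι) {F : ι → (V → ℝ) → ℝ}
    (hF : ∀ i ∈ s, MultiAffine (F i)) : MultiAffine fun x => ∑ i ∈ s, F i x := by
  intro x v t
  simp only [mul_sum, ← sum_add_distrib]
  exact sum_congr rfl fun i hi => hF i hi x v t

lemma MultiAffine.sub {V : Type*} [DecidableEq V] {F G : (V → ℝ) → ℝ}
    (hF : MultiAffine F) (hG : MultiAffine G) : MultiAffine fun x => F x - G x := by
  intro x v t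
  simp only [hF x v t, hG x v t]
  ring

lemma multiAffine_eval {V : Type*} [DecidableEq V] (a : V) : MultiAffine fun x : V → ℝ => x a := by
  intro x v t
  by_cases h : a = v
  · simp [h]
  · simp only [Function.update_of_ne h]
    ring

/-! ### Survival probabilities of colour classes -/

/-- `x ↦ F x` is a multi-affine lower bound for the indicator of the event that the random set `S`
contains both ends of an edge of the set `A`. -/
structure IsSurvivalBound {V : Type*} [DecidableEq V] (A : Set (Sym2 V)) (F : (V → ℝ) → ℝ) :
    Prop where
  multiAffine : MultiAffine F
  le_one : ∀ S : Finset V, F (fun v => if v ∈ S then 1 else 0) ≤ 1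
  nonpos : ∀ S : Finset V, (¬ ∃ e ∈ A, ∀ v ∈ e, v ∈ S) → F (fun v => if v ∈ S then 1 else 0) ≤ 0

/-- The polynomial is the inclusion–exclusion probability that one of the two edges survives;
distinctness of the vertices makes it affine in each variable. -/
lemma isSurvivalBound_path {V : Type*} [DecidableEq V] {A : Set (Sym2 V)} {a b c : V}
    (hab : a ≠ b) (hcb : c ≠ b) (hac : a ≠ c) (h1 : s(a, b) ∈ A) (h2 : s(c, b) ∈ A) :
    IsSurvivalBound A fun x => x b * (x a + x c - x a * x c) where
  multiAffine := by
    intro x v t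
    simp only [Function.update_apply]
    split_ifs <;> first | (exfalso; subst_vars; contradiction) | ring
  le_one S := by beta_reduce; split_ifs <;> norm_num
  nonpos S h := by
    have h1' : ¬ (a ∈ S ∧ b ∈ S) := fun hS => h ⟨_, h1, by simpa using hS⟩
    have h2' : ¬ (c ∈ S ∧ b ∈ S) := fun hS => h ⟨_, h2, by simpa using hS⟩
    beta_reduce
    split_ifs <;> first | (exfalso; tauto) | norm_num

lemma isSurvivalBound_triangle {V : Type*} [DecidableEq V] {A : Set (Sym2 V)} {a b c : V}
    (hab : a ≠ b) (hbc : b ≠ c) (hac : a ≠ c) (h1 : s(a, b) ∈ A) (h2 : s(b, c) ∈ A)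
    (h3 : s(a, c) ∈ A) :
    IsSurvivalBound A fun x => x a * x b + x b * x c + x a * x c - 2 * (x a * x b * x c) where
  multiAffine := by
    intro x v t
    simp only [Function.update_apply]
    split_ifs <;> first | (exfalso; subst_vars; contradiction) | ring
  le_one S := by beta_reduce; split_ifs <;> norm_num
  nonpos S h := by
    have h1' : ¬ (a ∈ S ∧ b ∈ S) := fun hS => h ⟨_, h1, by simpa using hS⟩
    have h2' : ¬ (b ∈ S ∧ c ∈ S) := fun hS => h ⟨_, h2, by simpa using hS⟩
    have h3' : ¬ (a ∈ S ∧ c ∈ S) := fun hS => h ⟨_, h3, by simpa using hS⟩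
    beta_reduce
    split_ifs <;> first | (exfalso; tauto) | norm_num

lemma isSurvivalBound_matching {V : Type*} [DecidableEq V] {A : Set (Sym2 V)} {a b c d : V}
    (hab : a ≠ b) (hcd : c ≠ d) (hac : a ≠ c) (had : a ≠ d) (hbc : b ≠ c) (hbd : b ≠ d)
    (h1 : s(a, b) ∈ A) (h2 : s(c, d) ∈ A) :
    IsSurvivalBound A fun x => x a * x b + x c * x d - x a * x b * (x c * x d) where
  multiAffine := by
    intro x v t
    simp only [Function.update_apply]
    split_ifs <;> first | (exfalso; subst_vars; contradiction) | ring
  le_one S := by beta_reduce; split_ifs <;> norm_num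
  nonpos S h := by
    have h1' : ¬ (a ∈ S ∧ b ∈ S) := fun hS => h ⟨_, h1, by simpa using hS⟩
    have h2' : ¬ (c ∈ S ∧ d ∈ S) := fun hS => h ⟨_, h2, by simpa using hS⟩
    beta_reduce
    split_ifs <;> first | (exfalso; tauto) | norm_num

/-- Two distinct edges survive the deletion of each vertex with probability `p` with at least the
probability that a path of length two survives. -/
lemma exists_isSurvivalBound_of_nontrivial {V : Type*} [DecidableEq V] {A : Set (Sym2 V)}
    (hA : ∀ e ∈ A, ¬ e.IsDiag) (hA2 : A.Nontrivial) (hM : ¬ ContainsTwoMatching A) (p : ℝ)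
    (hp : 0 ≤ p) :
    ∃ F, IsSurvivalBound A F ∧ 1 - p - p ^ 2 ≤ F fun _ => 1 - p := by
  obtain ⟨e, he, f, hf, hef⟩ := hA2
  obtain ⟨b, hbe, hbf⟩ : ∃ b : V, b ∈ e ∧ b ∈ f := by
    by_contra! h
    exact hM ⟨e, he, f, hf, h⟩
  obtain ⟨a, rfl⟩ := Sym2.mem_iff_exists.1 hbe
  obtain ⟨c, rfl⟩ := Sym2.mem_iff_exists.1 hbf
  have hab : a ≠ b := fun h => hA _ he (by simp [h])
  have hcb : c ≠ b := fun h => hA _ hf (by simp [h])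
  have hac : a ≠ c := fun h => hef (by rw [h])
  rw [Sym2.eq_swap] at he hf
  refine ⟨_, isSurvivalBound_path hab hcb hac he hf, ?_⟩
  have : 0 ≤ p ^ 3 := by positivity
  linarith [show (1 - p) * (1 - p + (1 - p) - (1 - p) * (1 - p)) = 1 - p - p ^ 2 + p ^ 3 by ring]

/-- A two-matching or a triangle survives the deletion of each vertex with probability `p` with
probability at least `1 - 4 p ^ 2`. -/
lemma exists_isSurvivalBound_of_matching_or_triangle {V : Type*} [DecidableEq V]
    {A : Set (Sym2 V)} (hA : ∀ e ∈ A, ¬ e.IsDiag)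
    (h : ContainsTwoMatching A ∨ ContainsTriangle A) (p : ℝ) (hp : 0 ≤ p) (hp1 : p ≤ 1) :
    ∃ F, IsSurvivalBound A F ∧ 1 - 4 * p ^ 2 ≤ F fun _ => 1 - p := by
  rcases h with ⟨e, he, f, hf, hef⟩ | ⟨a, b, c, hab, hbc, hac, h1, h2, h3⟩
  · induction e with | _ a b
    induction f with | _ c d
    have hab : a ≠ b := fun h => hA _ he (by simp [h])
    have hcd : c ≠ d := fun h => hA _ hf (by simp [h])
    have ha := hef a (by simp)
    have hb := hef b (by simp)
    simp only [Sym2.mem_iff, not_or] at ha hb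
    refine ⟨_, isSurvivalBound_matching hab hcd ha.1 ha.2 hb.1 hb.2 he hf, ?_⟩
    have : 0 ≤ p ^ 3 * (4 - p) := mul_nonneg (by positivity) (by linarith)
    linarith [show (1 - p) * (1 - p) + (1 - p) * (1 - p) - (1 - p) * (1 - p) * ((1 - p) * (1 - p))
      = 1 - 4 * p ^ 2 + p ^ 3 * (4 - p) by ring]
  · refine ⟨_, isSurvivalBound_triangle hab hbc hac h1 h2 h3, ?_⟩
    have : 0 ≤ p ^ 2 + 2 * p ^ 3 := by positivity
    linarith [show (1 - p) * (1 - p) + (1 - p) * (1 - p) + (1 - p) * (1 - p)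
      - 2 * ((1 - p) * (1 - p) * (1 - p)) = 1 - 4 * p ^ 2 + (p ^ 2 + 2 * p ^ 3) by ring]

open Classical in
/-- Some set `S` of vertices contains edges of many more sets `A i` than it has vertices. -/
theorem exists_many_survivors {V ι : Type*} [Fintype V] [Fintype ι] (A : ι → Set (Sym2 V))
    (hι : Fintype.card ι = Fintype.card V) (hA : ∀ i, ∀ e ∈ A i, ¬ e.IsDiag)
    (hA2 : ∀ i, (A i).Nontrivial) (M : Finset ι)
    (hM : ∀ i, i ∈ M ↔ ContainsTwoMatching (A i) ∨ ContainsTriangle (A i)) (hV : 0 < Fintype.card V) :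
    ∃ S : Finset V, (#S : ℝ) + (#M : ℝ) ^ 2 / (16 * Fintype.card V) ≤
      #(univ.filter fun i => ∃ e ∈ A i, ∀ v ∈ e, v ∈ S) := by
  set n : ℝ := (Fintype.card V : ℝ) with hn
  set m : ℝ := (#M : ℝ) with hm
  have hn0 : 0 < n := Nat.cast_pos.2 hV
  have hm0 : 0 ≤ m := by positivity
  have hmn : m ≤ n := by
    rw [hm, hn, ← hι]
    exact_mod_cast card_le_univ M
  -- This `p` maximises the expected gain `m * p - 4 * n * p ^ 2`.
  set p : ℝ := m / (8 * n) with hp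
  have hp0 : 0 ≤ p := by positivity
  have hp1 : p ≤ 1 := by
    rw [hp, div_le_one (by positivity)]
    linarith
  have hF : ∀ i, ∃ F, IsSurvivalBound (A i) F ∧
      (1 - p - p ^ 2 + if i ∈ M then p - 3 * p ^ 2 else 0) ≤ F fun _ => 1 - p := by
    intro i
    by_cases hi : i ∈ M
    · obtain ⟨F, hF, hle⟩ := exists_isSurvivalBound_of_matching_or_triangle (hA i) ((hM i).1 hi)
        p hp0 hp1
      refine ⟨F, hF, le_trans (le_of_eq ?_) hle⟩
      rw [if_pos hi]
      ring
    · obtain ⟨F, hF, hle⟩ := exists_isSurvivalBound_of_nontrivial (hA i) (hA2 i)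
        (fun h => hi ((hM i).2 (Or.inl h))) p hp0
      exact ⟨F, hF, by simpa [hi] using hle⟩
  choose F hF hle using hF
  have hmulti : MultiAffine fun x => ∑ i, F i x - ∑ v : V, x v :=
    (MultiAffine.sum _ fun i _ => (hF i).multiAffine).sub
      (MultiAffine.sum _ fun v _ => multiAffine_eval v)
  obtain ⟨S, hS⟩ := hmulti.exists_indicator_ge (fun _ => 1 - p)
    (fun v => ⟨by linarith, by linarith⟩)
  refine ⟨S, ?_⟩
  have hlow : n * (1 - p - p ^ 2) + m * (p - 3 * p ^ 2) ≤ ∑ i, F i fun _ => 1 - p := by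
    refine le_trans (le_of_eq ?_) (sum_le_sum fun i _ => hle i)
    rw [sum_add_distrib, sum_const, card_univ, hι, sum_ite_mem, univ_inter, sum_const,
      nsmul_eq_mul, nsmul_eq_mul]
  have hup : ∑ i, F i (fun v => if v ∈ S then 1 else 0) ≤
      #(univ.filter fun i => ∃ e ∈ A i, ∀ v ∈ e, v ∈ S) := by
    rw [card_filter, Nat.cast_sum]
    refine sum_le_sum fun i _ => ?_
    split_ifs with h
    · simpa using (hF i).le_one S
    · simpa using (hF i).nonpos S h
  have hvert : ∑ v : V, (if v ∈ S then (1 : ℝ) else 0) = #S := by simp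
  have hvert' : ∑ _v : V, (1 - p) = n * (1 - p) := by
    rw [sum_const, card_univ, nsmul_eq_mul]
  simp only [hvert, hvert'] at hS
  have hval : m ^ 2 / (16 * n) = m * p - 4 * n * p ^ 2 := by
    rw [hp]
    field_simp
    ring
  -- Bounds the total quadratic loss `n * p ^ 2 + 3 * m * p ^ 2` by `4 * n * p ^ 2`.
  have : m * p ^ 2 ≤ n * p ^ 2 := by gcongr
  linarith

/-! ### From colour classes to rainbow cycles -/

/-- Two distinct edges meet in a single vertex, and an edge missing it but meeting both closes a
triangle. -/
lemma isStar_of_not_containsTwoMatching_of_not_containsTriangle {V : Type*} {A : Set (Sym2 V)}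
    (hA : ∀ e ∈ A, ¬ e.IsDiag) (hA2 : A.Nontrivial) (hM : ¬ ContainsTwoMatching A)
    (hT : ¬ ContainsTriangle A) : IsStar A := by
  have hmeet : ∀ e ∈ A, ∀ f ∈ A, ∃ v : V, v ∈ e ∧ v ∈ f := by
    intro e he f hf
    by_contra! h
    exact hM ⟨e, he, f, hf, h⟩
  obtain ⟨e, he, f, hf, hef⟩ := hA2
  obtain ⟨b, hbe, hbf⟩ := hmeet e he f hf
  refine ⟨b, fun g hg => ?_⟩
  by_contra hbg
  obtain ⟨a, rfl⟩ := Sym2.mem_iff_exists.1 hbe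
  obtain ⟨c, rfl⟩ := Sym2.mem_iff_exists.1 hbf
  have hba : b ≠ a := fun h => hA _ he (by simp [h])
  have hbc : b ≠ c := fun h => hA _ hf (by simp [h])
  have hac : a ≠ c := fun h => hef (by rw [h])
  obtain ⟨u, hu, hug⟩ := hmeet _ he g hg
  obtain ⟨v, hv, hvg⟩ := hmeet _ hf g hg
  rcases Sym2.mem_iff.1 hu with rfl | rfl
  · exact hbg hug
  rcases Sym2.mem_iff.1 hv with rfl | rfl
  · exact hbg hvg
  exact hT ⟨b, u, v, hba, hac, hbc, he, (Sym2.mem_and_mem_iff hac).1 ⟨hug, hvg⟩ ▸ hg, hf⟩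

lemma not_isDiag_of_mem_colorClass {V K : Type*} {G : SimpleGraph V} {C : G.EdgeLabeling K}
    {i : K} {e : Sym2 V} (he : e ∈ colorClass C i) : ¬ e.IsDiag :=
  G.not_isDiag_of_mem_edgeSet he.1

lemma eq_of_mem_colorClass {V K : Type*} {G : SimpleGraph V} {C : G.EdgeLabeling K}
    {i j : K} {e : Sym2 V} (hi : e ∈ colorClass C i) (hj : e ∈ colorClass C j) : i = j := by
  obtain ⟨_, rfl⟩ := hi
  obtain ⟨_, rfl⟩ := hj
  rfl

lemma nontrivial_colorClass {V K : Type*} {G : SimpleGraph V} {C : G.EdgeLabeling K} {i : K}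
    (h : 2 ≤ (colorClass C i).ncard) : (colorClass C i).Nontrivial :=
  (Set.one_lt_ncard_iff_nontrivial_and_finite.1 h).1

lemma rainbowGirthEReal_le {V K : Type*} {G : SimpleGraph V} (C : G.EdgeLabeling K) {v : V}
    {w : G.Walk v v} (hw : w.IsCycle) (hC : IsRainbow C w.toSubgraph) {x : ℝ}
    (hx : (w.length : ℝ) ≤ x) : rainbowGirthEReal C ≤ (x : EReal) := by
  have h : rainbowGirth C ≤ w.length :=
    iInf_le_of_le v (iInf_le_of_le w (iInf_le_of_le hw (iInf_le _ hC)))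
  have h2 : ENat.toENNReal (rainbowGirth C) ≤ (w.length : ENNReal) := by
    simpa using ENat.toENNReal_le.2 h
  calc rainbowGirthEReal C ≤ ((w.length : ENNReal) : EReal) :=
        EReal.coe_ennreal_le_coe_ennreal_iff.2 h2
    _ = ((w.length : ℝ) : EReal) := by
        rw [← ENNReal.coe_natCast, EReal.coe_nnreal_eq_coe_real, NNReal.coe_natCast]
    _ ≤ x := EReal.coe_le_coe_iff.2 hx

/-- Picking one edge from each colour class gives a rainbow subgraph. -/
theorem exists_rainbow_isCycle {V K : Type*} {G : SimpleGraph V} (C : G.EdgeLabeling K)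
    (e : K → Sym2 V) (he : ∀ i, e i ∈ colorClass C i) {v : V}
    (c : (SimpleGraph.fromEdgeSet (Set.range e)).Walk v v) (hc : c.IsCycle) :
    ∃ w : G.Walk v v, w.IsCycle ∧ IsRainbow C w.toSubgraph ∧ w.length = c.length := by
  have hle : SimpleGraph.fromEdgeSet (Set.range e) ≤ G := by
    rw [← SimpleGraph.edgeSet_subset_edgeSet, SimpleGraph.edgeSet_fromEdgeSet]
    rintro _ ⟨⟨i, rfl⟩, -⟩
    exact (he i).1
  refine ⟨c.mapLe hle, hc.mapLe hle, fun i f hf g hg => ?_, by simp⟩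
  have key : ∀ f ∈ (c.mapLe hle).toSubgraph.edgeSet ∩ colorClass C i, f = e i := by
    rintro f ⟨hf, hfi⟩
    rw [SimpleGraph.Walk.mem_edges_toSubgraph, SimpleGraph.Walk.edges_mapLe_eq_edges] at hf
    have := c.edges_subset_edgeSet hf
    rw [SimpleGraph.edgeSet_fromEdgeSet] at this
    obtain ⟨⟨j, rfl⟩, -⟩ := this
    rw [eq_of_mem_colorClass (he j) hfi]
  rw [key f hf, key g hg]

/-- The excess of surviving colours over surviving vertices forces a short rainbow cycle. -/
theorem rainbowGirthEReal_le_of_lt {V : Type*} [Fintype V] {n : ℕ} (hn : 1 ≤ n)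
    (hV : Fintype.card V = n) {G : SimpleGraph V} (C : G.EdgeLabeling (Fin n))
    (hC : ∀ i : Fin n, 2 ≤ (colorClass C i).ncard) {k : ℝ} (hk : 0 < k)
    (hkm : k < ({i : Fin n | ContainsTwoMatching (colorClass C i) ∨
      ContainsTriangle (colorClass C i)}.ncard : ℝ) ^ 2 / (16 * n)) :
    rainbowGirthEReal C ≤ ((2 * (n / k) * Real.logb 2 (1 + k) : ℝ) : EReal) := by
  classical
  rw [Set.ncard_eq_toFinset_card'] at hkm
  set M := Set.toFinset {i : Fin n | ContainsTwoMatching (colorClass C i) ∨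
      ContainsTriangle (colorClass C i)} with hM
  have hn0 : (0 : ℝ) < n := by exact_mod_cast hn
  obtain ⟨S, hS⟩ := exists_many_survivors (fun i => colorClass C i) (by simp [hV])
    (fun i e he => not_isDiag_of_mem_colorClass he) (fun i => nontrivial_colorClass (hC i)) M
    (fun i => by simp [hM]) (by omega)
  set I := univ.filter fun i => ∃ e ∈ colorClass C i, ∀ v ∈ e, v ∈ S with hI
  -- Colours without an edge inside `S` get an arbitrary edge: the graph stays rainbow, and the
  -- excess inside `S` only needs the colours in `I`.
  have hpick : ∀ i, ∃ e ∈ colorClass C i, i ∈ I → ∀ v ∈ e, v ∈ S := by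
    intro i
    by_cases hi : i ∈ I
    · obtain ⟨e, he, heS⟩ := (mem_filter.1 hi).2
      exact ⟨e, he, fun _ => heS⟩
    · obtain ⟨e, he⟩ := (nontrivial_colorClass (hC i)).nonempty
      exact ⟨e, he, fun h => absurd h hi⟩
  choose e he heS using hpick
  have hcard : #I ≤ #(edgesIn (SimpleGraph.fromEdgeSet (Set.range e)) S) := by
    refine card_le_card_of_injOn e (fun i hi => ?_) fun i _ j _ hij =>
      eq_of_mem_colorClass (he i) (hij ▸ he j)
    refine mem_edgesIn.2 ⟨?_, heS i hi⟩
    rw [SimpleGraph.edgeSet_fromEdgeSet]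
    exact ⟨⟨i, rfl⟩, not_isDiag_of_mem_colorClass (he i)⟩
  have hMn : (#M : ℝ) ≤ n := by
    simpa using (Nat.cast_le (α := ℝ)).2 (card_le_univ M)
  have hkn : k ≤ n := by
    refine hkm.le.trans ((div_le_iff₀ (by positivity)).2 ?_)
    nlinarith
  rw [hV] at hS
  have hcard' : (#I : ℝ) ≤ _ := Nat.cast_le.2 hcard
  obtain ⟨u, c, hc, hlen⟩ := exists_short_cycle (SimpleGraph.fromEdgeSet (Set.range e)) S n k hk
    hkn (by rw [hV]) (by linarith)
  obtain ⟨w, hw, hwC, hwlen⟩ := exists_rainbow_isCycle C e he c hc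
  exact rainbowGirthEReal_le C hw hwC (by rw [hwlen]; exact hlen)

/-! ### Numerical estimates and conclusion -/

/-- For `K ≥ 3`, `1 + 2 * K ≤ K ^ 2`, so taking the excess to be `2 * K` absorbs the extra factor in
the logarithm. -/
lemma logb_bound {K : ℝ} (hK : 3 ≤ K) (n : ℝ) (hn : 0 ≤ n) :
    2 * (n / (2 * K)) * Real.logb 2 (1 + 2 * K) ≤ 2 * Real.logb 2 K / K * n := by
  have h : Real.logb 2 (1 + 2 * K) ≤ 2 * Real.logb 2 K := by
    have : Real.logb 2 (K ^ 2) = 2 * Real.logb 2 K := by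
      rw [Real.logb_pow]
      norm_num
    rw [← this]
    exact Real.logb_le_logb_of_le (by norm_num) (by linarith) (by nlinarith)
  calc 2 * (n / (2 * K)) * Real.logb 2 (1 + 2 * K) = n / K * Real.logb 2 (1 + 2 * K) := by
        field_simp
    _ ≤ n / K * (2 * Real.logb 2 K) := by gcongr
    _ = _ := by ring

lemma exists_logb_div_le {ε : ℝ} (hε : 0 < ε) :
    ∃ k : ℝ, 0 < k ∧ 2 * (Real.logb 2 (1 + k) / k) ≤ ε := by
  have h := (Real.isLittleO_log_id_atTop.def (show 0 < ε * Real.log 2 / 4 by positivity))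
  obtain ⟨y, hy, hy2⟩ := (h.and (Filter.eventually_ge_atTop 2)).exists
  refine ⟨y - 1, by linarith, ?_⟩
  have hlog2 : 0 < Real.log 2 := Real.log_pos (by norm_num)
  rw [Real.norm_of_nonneg (Real.log_nonneg (by linarith)), id,
    Real.norm_of_nonneg (by linarith)] at hy
  rw [add_sub_cancel, ← mul_div_assoc, div_le_iff₀ (by linarith), Real.logb, ← mul_div_assoc,
    div_le_iff₀ hlog2]
  -- Since `y ≥ 2`, `y ≤ 2 * (y - 1)`; this and the factor 2 in the claim account for the 4.
  nlinarith [mul_pos hε hlog2]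

end RainbowGirth

theorem mainTheorem6 :
    -- the explicit bound
    (∃ L₀ : ℝ, 0 < L₀ ∧ ∀ c L : ℝ, 0 ≤ c → c ≤ 1 / 2 → L₀ ≤ L →
      ∀ (n : ℕ), 1 ≤ n → ∀ (V : Type*) [Fintype V], Fintype.card V = n →
      ∀ (G : SimpleGraph V) (C : G.EdgeLabeling (Fin n)),
        (∀ i : Fin n, 2 ≤ (RainbowGirth.colorClass C i).ncard) →
        L * (n : ℝ) ^ (1 - c) ≤
          ({i : Fin n | RainbowGirth.ContainsTwoMatching (RainbowGirth.colorClass C i) ∨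
              RainbowGirth.ContainsTriangle (RainbowGirth.colorClass C i)}.ncard : ℝ) →
        RainbowGirth.rainbowGirthEReal C ≤
          ((2 * Real.logb 2 (L / 100 * (n : ℝ) ^ (1 - 2 * c)) /
              (L / 100 * (n : ℝ) ^ (1 - 2 * c)) * (n : ℝ) : ℝ) : EReal)) ∧
    -- `ω(√n)` non-star classes force rainbow girth `o(n)`
    (∀ g : ℕ → ℝ, Filter.Tendsto (fun n : ℕ => g n / Real.sqrt n) Filter.atTop Filter.atTop →
      ∀ ε : ℝ, 0 < ε → ∃ N : ℕ, ∀ n : ℕ, N ≤ n →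
      ∀ (V : Type*) [Fintype V], Fintype.card V = n →
      ∀ (G : SimpleGraph V) (C : G.EdgeLabeling (Fin n)),
        (∀ i : Fin n, 2 ≤ (RainbowGirth.colorClass C i).ncard) →
        g n ≤ ({i : Fin n | ¬ RainbowGirth.IsStar (RainbowGirth.colorClass C i)}.ncard : ℝ) →
        RainbowGirth.rainbowGirthEReal C ≤ ((ε * (n : ℝ) : ℝ) : EReal)) := by
  constructor
  -- The value 300 ensures `K ≥ 3`, as `n ^ (1 - 2 * c) ≥ 1`.
  · refine ⟨300, by norm_num, fun c L hc hc' hL n hn V _ hV G C hC hm => ?_⟩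
    have hn1 : (1 : ℝ) ≤ n := by exact_mod_cast hn
    have hn0 : (0 : ℝ) < n := by linarith
    set Y : ℝ := (n : ℝ) ^ (1 - 2 * c) with hY
    have hY1 : 1 ≤ Y := Real.one_le_rpow hn1 (by linarith)
    have hsq : ((n : ℝ) ^ (1 - c)) ^ 2 = Y * n := by
      rw [hY, ← Real.rpow_natCast, ← Real.rpow_mul hn0.le, ← Real.rpow_add_one hn0.ne']
      congr 1
      push_cast
      ring
    have hK : 3 ≤ L / 100 * Y := by nlinarith
    refine (RainbowGirth.rainbowGirthEReal_le_of_lt hn hV C hC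
      (k := 2 * (L / 100 * Y)) (by linarith) ?_).trans
      (EReal.coe_le_coe_iff.2 (RainbowGirth.logb_bound hK n hn0.le))
    rw [lt_div_iff₀ (by positivity)]
    have h1 : (L * (n : ℝ) ^ (1 - c)) ^ 2 ≤ _ := pow_le_pow_left₀ (by positivity) hm 2
    refine lt_of_lt_of_le ?_ h1
    rw [mul_pow, hsq]
    have : 0 < L * (Y * n) * (L - 32 / 100) := by
      have : 0 < L - 32 / 100 := by linarith
      positivity
    linarith
  · intro g hg ε hε
    obtain ⟨k, hk, hkε⟩ := RainbowGirth.exists_logb_div_le hε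
    obtain ⟨N, hN⟩ := Filter.eventually_atTop.1
      -- Then `m ^ 2 ≥ (4 * √k + 1) ^ 2 * n > 16 * k * n`, so the excess exceeds the fixed `k`,
      -- which depends only on `ε`.
      ((hg.eventually_ge_atTop (4 * √k + 1)).and (Filter.eventually_ge_atTop 1))
    refine ⟨N, fun n hNn V _ hV G C hC hm => ?_⟩
    obtain ⟨hgn, hn⟩ := hN n hNn
    have hn0 : (0 : ℝ) < n := by exact_mod_cast hn
    rw [le_div_iff₀ (Real.sqrt_pos.2 hn0)] at hgn
    have hsub : {i : Fin n | ¬ RainbowGirth.IsStar (RainbowGirth.colorClass C i)} ⊆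
        {i : Fin n | RainbowGirth.ContainsTwoMatching (RainbowGirth.colorClass C i) ∨
          RainbowGirth.ContainsTriangle (RainbowGirth.colorClass C i)} := by
      intro i hi
      by_contra hnot
      rw [Set.mem_ofPred_eq, not_or] at hnot
      exact hi (RainbowGirth.isStar_of_not_containsTwoMatching_of_not_containsTriangle
        (fun e he => RainbowGirth.not_isDiag_of_mem_colorClass he)
        (RainbowGirth.nontrivial_colorClass (hC i)) hnot.1 hnot.2)
    have hm' := hgn.trans (hm.trans (Nat.cast_le.2 (Set.ncard_le_ncard hsub (Set.toFinite _))))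
    refine (RainbowGirth.rainbowGirthEReal_le_of_lt hn hV C hC hk ?_).trans
      (EReal.coe_le_coe_iff.2 ?_)
    · rw [lt_div_iff₀ (by positivity)]
      refine lt_of_lt_of_le ?_ (pow_le_pow_left₀ (by positivity) hm' 2)
      rw [mul_pow, Real.sq_sqrt hn0.le, ← mul_assoc]
      refine mul_lt_mul_of_pos_right ?_ hn0
      nlinarith [Real.sq_sqrt hk.le, Real.sqrt_nonneg k]
    · calc 2 * (n / k) * Real.logb 2 (1 + k) = 2 * (Real.logb 2 (1 + k) / k) * n := by ring
        _ ≤ ε * n := by gcongr
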